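/- Let $\mathcal H=L^2(\mathbb R)$, let $Q$ be the position operator, $(Q\psi)(x)=x\psi(x)$, and $P$ the momentum operator, $(P\psi)(x)=-i\psi'(x)$ (each taken as the closure of its restriction to the Schwartz space). Let $a=\frac{1}{\sqrt2}(Q+iP)$ be the annihilation operator, let $Q_\theta$ be the closure of $\frac{1}{\sqrt2}(e^{i\theta}a^*+e^{-i\theta}a)$, and let $W(q,p)=e^{iqp/2}e^{-iqP}e^{ipQ}$ be the Weyl operators. For a self-adjoint operator $A$, $e^{itA}$ denotes the strongly continuous one-parameter unitary group with generator $A$. For $\theta\in(-\pi,0)\cup(0,\pi)$ let $f_\theta:\mathbb R^2\to\mathbb R^2$ be the linear map $f_\theta(q,p)=(q,\,q\cos\theta+p\sin\theta)$. Then the following hold. 1. The operators $Q$, $P$ and $Q_\theta$ are self-adjoint and generate the unitary groups $e^{itQ}$, $e^{itP}$, $e^{itQ_\theta}$; moreover $Q_0=Q$. The map $f_\theta$ is a bijection, so that $W_\theta(q,p):=W(f_\theta^{-1}(q,p))$ is well defined. 2. For all $q,p\in\mathbb R$, $$W_\theta(q,p)=e^{\frac{i}{2}\frac{qp}{\sin\theta}}\,e^{-\frac{iq}{\sin\theta}Q_\theta}\,e^{\frac{ip}{\sin\theta}Q}.$$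 3. The map $(q,p)\mapsto W_\theta(q,p)$ is a strongly continuous, irreducible projective unitary representation of $\mathbb R^2$ on $\mathcal H$ (irreducible: the only closed invariant subspaces are $\{0\}$ and $\mathcal H$), and for all $(q,p),(q',p')\in\mathbb R^2$, $$W_\theta(q+q',p+p')=e^{\frac{i}{2}\frac{qp'-pq'}{\sin\theta}}\,W_\theta(q,p)\,W_\theta(q',p').$$ 4. There is a unitary operator $V$ on $\mathcal H$ with $V\,W(q,p)=W_\theta(q,p)\,V$ for all $(q,p)\in\mathbb R^2$ if and only if $\theta=\frac{\pi}{2}$. The same holds for equivalence up to phases: there are a unitary $V$ and numbers $c(q,p)\in\mathbb C$ of modulus one with $V\,W(q,p)=c(q,p)\,W_\theta(q,p)\,V$ for all $(q,p)$ if and only if $\theta=\frac{\pi}{2}$. -/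

import Mathlib

open scoped SchwartzMap

noncomputable section

namespace TiltedWeyl

/-! ### One-parameter unitary groups and the exponential `e^{itA}` -/

section Stone

variable {E : Type*} [NormedAddCommGroup E] [InnerProductSpace ℂ E] [CompleteSpace E]

/-- `U` is a strongly continuous one-parameter unitary group whose infinitesimal generator is
exactly the (possibly unbounded) operator `A`: a vector `ψ` lies in the domain of `A` with
`A ψ = φ` if and only if `(U t ψ - ψ) / t → i φ` as `t → 0`. For a self-adjoint `A` this is the
characterization of `U t = e^{itA}` by Stone's theorem. -/
structure IsUnitaryGroupOf (A : E →ₗ.[ℂ] E) (U : ℝ → E →L[ℂ] E) : Prop where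
  unitary : ∀ t, U t ∈ unitary (E →L[ℂ] E)
  zero : U 0 = 1
  add : ∀ s t, U (s + t) = U s * U t
  continuous : ∀ ψ, Continuous fun t => U t ψ
  generator : ∀ ψ φ, (ψ, φ) ∈ A.graph ↔
    Filter.Tendsto (fun t : ℝ => (t : ℂ)⁻¹ • (U t ψ - ψ)) (nhdsWithin 0 {0}ᶜ)
      (nhds (Complex.I • φ))

open Classical in
/-- `expI A t` is the operator `e^{itA}`, that is, the unitary group generated by `A` at time `t`
(the group is unique for densely defined `A`, see `IsUnitaryGroupOf.unique`). If `A` generates no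
unitary group, the value is `0`. -/
def expI (A : E →ₗ.[ℂ] E) (t : ℝ) : E →L[ℂ] E :=
  if h : ∃ U : ℝ → E →L[ℂ] E, IsUnitaryGroupOf A U then h.choose t else 0

theorem IsUnitaryGroupOf.hasDerivAt {A : E →ₗ.[ℂ] E} {U : ℝ → E →L[ℂ] E}
    (hU : IsUnitaryGroupOf A U) {ψ φ : E} (h : (ψ, φ) ∈ A.graph) (t : ℝ) :
    HasDerivAt (fun s : ℝ => U s ψ) (U t (Complex.I • φ)) t := by
  rw [hasDerivAt_iff_tendsto_slope_zero]
  have h1 := ((U t).continuous.tendsto _).comp ((hU.generator ψ φ).1 h)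
  refine h1.congr fun s => ?_
  have : (s⁻¹ : ℝ) • (U (t + s) ψ - U t ψ) = ((s⁻¹ : ℝ) : ℂ) • (U (t + s) ψ - U t ψ) :=
    (Complex.coe_smul _ _).symm
  rw [this, hU.add]
  simp

theorem IsUnitaryGroupOf.inner_eq {A : E →ₗ.[ℂ] E} {U : ℝ → E →L[ℂ] E}
    (hU : IsUnitaryGroupOf A U) (t : ℝ) (x y : E) :
    inner ℂ (U t x) (U t y) = inner ℂ x y := by
  have h := (Unitary.mem_iff.1 (hU.unitary t)).1
  rw [← ContinuousLinearMap.adjoint_inner_right, ← ContinuousLinearMap.star_eq_adjoint,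
    ← mul_apply_eq_comp, h, one_apply_eq_self]

theorem IsUnitaryGroupOf.symmetric {A : E →ₗ.[ℂ] E} {U : ℝ → E →L[ℂ] E}
    (hU : IsUnitaryGroupOf A U) {x y z w : E} (hx : (x, y) ∈ A.graph) (hz : (z, w) ∈ A.graph) :
    inner ℂ (Complex.I • y) z + inner ℂ x (Complex.I • w) = 0 := by
  have h := (hU.hasDerivAt hx 0).inner ℂ (hU.hasDerivAt hz 0)
  simp only [hU.inner_eq] at h
  have h' := h.unique (hasDerivAt_const (0 : ℝ) (inner ℂ x z))
  rw [add_comm]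
  exact h'

theorem IsUnitaryGroupOf.mem_graph {A : E →ₗ.[ℂ] E} {U : ℝ → E →L[ℂ] E}
    (hU : IsUnitaryGroupOf A U) {x y : E} (hx : (x, y) ∈ A.graph) (t : ℝ) :
    (U t x, U t y) ∈ A.graph := by
  rw [hU.generator]
  have h1 := ((U t).continuous.tendsto _).comp ((hU.generator x y).1 hx)
  simp only [map_smul] at h1
  refine h1.congr fun s => ?_
  have h2 : U s (U t x) = U t (U s x) := by
    rw [← mul_apply_eq_comp, ← mul_apply_eq_comp, ← hU.add, ← hU.add,
      add_comm]
  simp [h2]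

/-- A unitary group is determined by its generator. -/
theorem IsUnitaryGroupOf.unique {A : E →ₗ.[ℂ] E} {U V : ℝ → E →L[ℂ] E}
    (hA : Dense (A.domain : Set E)) (hU : IsUnitaryGroupOf A U) (hV : IsUnitaryGroupOf A V) :
    U = V := by
  have key : ∀ ψ φ : E, (ψ, φ) ∈ A.graph → ∀ t, U t ψ = V t ψ := by
    intro ψ φ h t
    have hd : ∀ s, HasDerivAt (fun s : ℝ => inner ℂ (U s ψ) (V s ψ)) (0 : ℂ) s := by
      intro s
      have h1 := (hU.hasDerivAt h s).inner ℂ (hV.hasDerivAt h s)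
      have h2 := hU.symmetric (hU.mem_graph h s) (hV.mem_graph h s)
      rw [add_comm, ← map_smul, ← map_smul] at h2
      rwa [h2] at h1
    have hc := is_const_of_deriv_eq_zero (fun s => (hd s).differentiableAt)
      (fun s => (hd s).deriv) t 0
    simp only [hU.zero, hV.zero, one_apply_eq_self] at hc
    have hc' : inner ℂ (V t ψ) (U t ψ) = inner ℂ ψ ψ := by
      rw [← inner_conj_symm, hc, inner_conj_symm]
    rw [← sub_eq_zero, ← inner_self_eq_zero (𝕜 := ℂ), inner_sub_left, inner_sub_right,
      inner_sub_right, hU.inner_eq, hV.inner_eq, hc, hc']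
    ring
  funext t
  refine DFunLike.coe_injective (Continuous.ext_on hA (U t).continuous (V t).continuous ?_)
  intro ψ hψ
  exact key ψ (A ⟨ψ, hψ⟩) (A.mem_graph ⟨ψ, hψ⟩) t

theorem expI_eq {A : E →ₗ.[ℂ] E} {U : ℝ → E →L[ℂ] E}
    (hA : Dense (A.domain : Set E)) (hU : IsUnitaryGroupOf A U) : expI A = U := by
  have h : ∃ U : ℝ → E →L[ℂ] E, IsUnitaryGroupOf A U := ⟨U, hU⟩
  have : expI A = h.choose := by
    funext t
    simp only [expI, dif_pos h]
  rw [this]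
  exact h.choose_spec.unique hA hU

end Stone

/-! ### Projective unitary representations -/

section Representation

variable {G : Type*} [AddCommGroup G] [TopologicalSpace G]
variable {E : Type*} [NormedAddCommGroup E] [InnerProductSpace ℂ E] [CompleteSpace E]

/-- `U` is a (strongly continuous) projective unitary representation of `G` with multiplier `m`,
in the convention `U (x + y) = m x y • (U x * U y)`. -/
structure IsProjectiveUnitaryRep (m : G → G → ℂ) (U : G → E →L[ℂ] E) : Prop where
  unitary : ∀ x, U x ∈ unitary (E →L[ℂ] E)
  norm_multiplier : ∀ x y, ‖m x y‖ = 1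
  add : ∀ x y, U (x + y) = m x y • (U x * U y)
  continuous : ∀ ψ, Continuous fun x => U x ψ

/-- The space is nonzero and has no closed invariant subspaces except `0` and itself. -/
def IsIrreducible (U : G → E →L[ℂ] E) : Prop :=
  Nontrivial E ∧ ∀ K : Submodule ℂ E, IsClosed (K : Set E) →
    (∀ x, ∀ ψ ∈ K, U x ψ ∈ K) → K = ⊥ ∨ K = ⊤

/-- `V U₁(x) = U₂(x) V` for all `x`, for some unitary `V`. -/
def UnitarilyEquivalent (U₁ U₂ : G → E →L[ℂ] E) : Prop :=
  ∃ V : E ≃ₗᵢ[ℂ] E, ∀ x ψ, V (U₁ x ψ) = U₂ x (V ψ)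

/-- `V U₁(x) = c(x) U₂(x) V` for all `x`, for some unitary `V` and phases `c(x)`. -/
def UnitarilyEquivalentUpToPhase (U₁ U₂ : G → E →L[ℂ] E) : Prop :=
  ∃ (V : E ≃ₗᵢ[ℂ] E) (c : G → ℂ), (∀ x, ‖c x‖ = 1) ∧ ∀ x ψ, V (U₁ x ψ) = c x • U₂ x (V ψ)

end Representation

/-! ### Position, momentum and quadratures on `L²(ℝ)` -/

/-- The Hilbert space `L²(ℝ)` of the signal mode, in the coordinate representation. -/
abbrev H : Type := MeasureTheory.Lp ℂ 2 (MeasureTheory.volume : MeasureTheory.Measure ℝ)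

/-- The inclusion of the Schwartz space in `L²(ℝ)`. -/
def incl : 𝓢(ℝ, ℂ) →ₗ[ℂ] H :=
  (SchwartzMap.toLpCLM ℂ ℂ 2 (MeasureTheory.volume : MeasureTheory.Measure ℝ)).toLinearMap

theorem incl_injective : Function.Injective incl :=
  SchwartzMap.injective_toLp 2 (MeasureTheory.volume : MeasureTheory.Measure ℝ)

/-- The operator in `L²(ℝ)` with the Schwartz space as its domain, on which it acts as `T`. -/
def schwartzOp (T : 𝓢(ℝ, ℂ) →ₗ[ℂ] 𝓢(ℝ, ℂ)) : H →ₗ.[ℂ] H where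
  domain := LinearMap.range incl
  toFun := (incl ∘ₗ T) ∘ₗ (LinearEquiv.ofInjective incl incl_injective).symm.toLinearMap

/-- `f ↦ (x ↦ x f(x))` on the Schwartz space. -/
def mulX : 𝓢(ℝ, ℂ) →ₗ[ℂ] 𝓢(ℝ, ℂ) :=
  (SchwartzMap.smulLeftCLM ℂ (fun x : ℝ => (x : ℂ))).toLinearMap

theorem mulX_apply (f : 𝓢(ℝ, ℂ)) (x : ℝ) : mulX f x = x * f x := by
  have h : (fun x : ℝ => (x : ℂ)).HasTemperateGrowth := Complex.ofRealCLM.hasTemperateGrowth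
  exact SchwartzMap.smulLeftCLM_apply_apply h f x

/-- `f ↦ -i f'` on the Schwartz space. -/
def negIDeriv : 𝓢(ℝ, ℂ) →ₗ[ℂ] 𝓢(ℝ, ℂ) :=
  (-Complex.I) • (SchwartzMap.derivCLM ℂ ℂ).toLinearMap

/-- The position operator `Q`, `(Qψ)(x) = x ψ(x)`: the closure of its restriction to the Schwartz
space. -/
def position : H →ₗ.[ℂ] H := (schwartzOp mulX).closure

/-- The momentum operator `P`, `(Pψ)(x) = -i ψ'(x)`: the closure of its restriction to the Schwartz
space. -/
def momentum : H →ₗ.[ℂ] H := (schwartzOp negIDeriv).closure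

/-- The annihilation operator `a = (Q + iP) / √2`, on the intersection of the domains of `Q` and
`P`. -/
def annihilation : H →ₗ.[ℂ] H :=
  ((√2 : ℝ) : ℂ)⁻¹ • (position + Complex.I • momentum)

/-- The quadrature operator `Q_θ`, the closure of `(e^{iθ} a* + e^{-iθ} a) / √2`. -/
def quadrature (θ : ℝ) : H →ₗ.[ℂ] H :=
  (((√2 : ℝ) : ℂ)⁻¹ • (Complex.exp (Complex.I * θ) • annihilation.adjoint +
    Complex.exp (-(Complex.I * θ)) • annihilation)).closure

/-! ### Weyl operators -/

/-- The Weyl operator `W(q,p) = e^{iqp/2} e^{-iqP} e^{ipQ}`. -/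
def weyl (z : ℝ × ℝ) : H →L[ℂ] H :=
  Complex.exp (Complex.I * (z.1 * z.2 / 2)) • (expI momentum (-z.1) * expI position z.2)

/-- The linear map `f_θ(q,p) = (q, q cos θ + p sin θ)`. -/
def tilt (θ : ℝ) : ℝ × ℝ →ₗ[ℝ] ℝ × ℝ where
  toFun z := (z.1, z.1 * Real.cos θ + z.2 * Real.sin θ)
  map_add' z w := by ext <;> simp; ring
  map_smul' c z := by ext <;> simp; ring

/-- The tilted Weyl operator `W_θ(q,p) = W(f_θ⁻¹(q,p))`; `f_θ` is bijective if `sin θ ≠ 0`. -/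
def tiltedWeyl (θ : ℝ) (z : ℝ × ℝ) : H →L[ℂ] H :=
  weyl (Function.invFun (tilt θ) z)

/-- `m_θ((q,p),(q',p')) = e^{i(qp' - pq')/(2 sin θ)}`. -/
def tiltedMultiplier (θ : ℝ) (z w : ℝ × ℝ) : ℂ :=
  Complex.exp (Complex.I * ((z.1 * w.2 - z.2 * w.1) / (2 * Real.sin θ)))

end TiltedWeyl

end

/-! Everything reduces to the displacements `D(q,p)ψ(x) = e^{i(px - qp/2)} ψ(x - q)`, unitaries that
multiply up to a phase given by the symplectic form `qp' - pq'`. Along the line `t ↦ (-st, ct)` this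
phase is trivial, so they form a strongly continuous group, which preserves the Schwartz space and
has derivative `i(cQ + sP)` there. By Nelson's invariant-domain criterion
(`isSelfAdjoint_closure_of_invariant`), `cQ + sP` is essentially self-adjoint on Schwartz functions
and its closure generates that group (`schwartzOp_linComb`). This covers `Q`, `P` and, since `Q_θ`
is the closure of `cos θ Q + sin θ P` (`quadrature_eq`), all three operators.

Hence `W = D` and `W_θ = D ∘ f_θ⁻¹`. The inverse tilt has determinant `1 / sin θ` and rescales the
symplectic form by it, which gives the multiplier. Irreducibility is that of `D`: a vanishing matrix
element `⟪φ, D(z)ψ⟫` for all `z` forces `φ = 0` or `ψ = 0`, by Fourier injectivity and Tonelli.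
Finally, the commutation phase of two operators survives unitary conjugation and rephasing, so
equivalence forces `sin θ = 1`; conversely `f_θ` is the identity at `θ = π/2`. -/

open scoped SchwartzMap InnerProductSpace ContDiff

noncomputable section

namespace TiltedWeyl

/-! ### Adjoints of linear relations and the invariant-domain criterion for essential
self-adjointness. -/

section Core

open LinearPMap Filter Topology

variable {E : Type*} [NormedAddCommGroup E] [InnerProductSpace ℂ E]

/-- The double adjoint of a linear relation is its closure. -/
theorem submodule_adjoint_adjoint [CompleteSpace E] (g : Submodule ℂ (E × E)) :
    g.adjoint.adjoint = g.topologicalClosure := by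
  apply le_antisymm
  · intro x hx
    -- Orthogonality needs the Hilbert structure of `WithLp 2`. There the adjoint is the orthogonal
    -- complement rotated by `(u₁, u₂) ↦ (-u₂, u₁)`, so the double adjoint is a double complement.
    set g' : Submodule ℂ (WithLp 2 (E × E)) :=
      g.map (WithLp.linearEquiv 2 ℂ (E × E)).symm.toLinearMap with hg'
    have hx' : WithLp.toLp 2 x ∈ g'ᗮᗮ := by
      rw [Submodule.mem_orthogonal]
      intro u hu
      rw [Submodule.mem_orthogonal] at hu
      have h1 : (-(WithLp.ofLp u).2, (WithLp.ofLp u).1) ∈ g.adjoint := by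
        rw [Submodule.mem_adjoint_iff]
        intro a b hab
        have := hu (WithLp.toLp 2 (a, b)) ⟨(a, b), hab, rfl⟩
        simp only [WithLp.prod_inner_apply] at this
        simp only [inner_neg_right]
        linear_combination -this
      have h2 := (Submodule.mem_adjoint_iff _ _).1 hx _ _ h1
      simp only [WithLp.prod_inner_apply]
      simp only [inner_neg_left] at h2
      linear_combination h2
    rw [Submodule.orthogonal_orthogonal_eq_closure] at hx'
    have h3 : WithLp.toLp 2 x ∈ closure (g' : Set (WithLp 2 (E × E))) := hx'
    have h4 := image_closure_subset_closure_image
      (WithLp.prod_continuous_ofLp 2 E E) ⟨_, h3, rfl⟩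
    refine closure_mono ?_ h4
    rintro _ ⟨_, ⟨y, hy, rfl⟩, rfl⟩
    exact hy
  · refine Submodule.topologicalClosure_minimal _ ?_ ?_
    · intro x hx
      rw [Submodule.mem_adjoint_iff]
      intro a b hab
      have := (Submodule.mem_adjoint_iff _ _).1 hab x.1 x.2 hx
      have h2 := congrArg (starRingEnd ℂ) this
      simp only [_root_.map_sub, inner_conj_symm, _root_.map_zero] at h2
      linear_combination -h2
    · have : (g.adjoint.adjoint : Set (E × E)) =
          ⋂ a : g.adjoint, {x | ⟪a.1.2, x.1⟫_ℂ - ⟪a.1.1, x.2⟫_ℂ = 0} := by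
        ext x
        simp only [SetLike.mem_coe, Submodule.mem_adjoint_iff g.adjoint, Set.mem_iInter,
          Subtype.forall, Prod.forall]
        rfl
      rw [this]
      exact isClosed_iInter fun a => isClosed_eq (by fun_prop) continuous_const

/-- Two vectors along which a unitary group is differentiable satisfy the symmetry relation of its
generator. -/
theorem inner_eq_of_tendsto {U : ℝ → E →L[ℂ] E}
    (hU : ∀ t x y, ⟪U t x, U t y⟫_ℂ = ⟪x, y⟫_ℂ) (h0 : U 0 = 1) {x y z w : E}
    (hx : Tendsto (fun t : ℝ => (t : ℂ)⁻¹ • (U t x - x)) (𝓝[≠] 0) (𝓝 (Complex.I • y)))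
    (hz : Tendsto (fun t : ℝ => (t : ℂ)⁻¹ • (U t z - z)) (𝓝[≠] 0) (𝓝 (Complex.I • w))) :
    ⟪y, z⟫_ℂ = ⟪x, w⟫_ℂ := by
  have key : ∀ {x y : E},
      Tendsto (fun t : ℝ => (t : ℂ)⁻¹ • (U t x - x)) (𝓝[≠] 0) (𝓝 (Complex.I • y)) →
      HasDerivAt (fun s : ℝ => U s x) (Complex.I • y) 0 := by
    intro x y h
    rw [hasDerivAt_iff_tendsto_slope_zero]
    refine h.congr fun s => ?_
    rw [← Complex.coe_smul, zero_add, h0]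
    simp
  have h := (key hx).inner ℂ (key hz)
  simp only [hU, h0, one_apply_eq_self] at h
  have h' := h.unique (hasDerivAt_const (0 : ℝ) (inner ℂ x z))
  simp only [inner_smul_left, inner_smul_right, Complex.conj_I] at h'
  have h2 : Complex.I * (⟪y, z⟫_ℂ - ⟪x, w⟫_ℂ) = 0 := by linear_combination -h'
  rcases mul_eq_zero.1 h2 with h3 | h3
  · exact absurd h3 Complex.I_ne_zero
  · exact sub_eq_zero.1 h3

variable [CompleteSpace E]

/-- A densely defined operator whose domain is invariant under a strongly continuous unitary group
and which is a restriction of the generator of that group is essentially self-adjoint, and its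
closure generates the group. -/
theorem isSelfAdjoint_closure_of_invariant {C : E →ₗ.[ℂ] E} {U : ℝ → E →L[ℂ] E}
    (hC : Dense (C.domain : Set E)) (hunit : ∀ t, U t ∈ unitary (E →L[ℂ] E)) (h0 : U 0 = 1)
    (hadd : ∀ s t, U (s + t) = U s * U t) (hcont : ∀ ψ, Continuous fun t => U t ψ)
    (hinv : ∀ t, ∀ ψ ∈ C.domain, U t ψ ∈ C.domain)
    (hder : ∀ ψ : C.domain, Tendsto (fun t : ℝ => (t : ℂ)⁻¹ • (U t ψ - ψ)) (𝓝[≠] 0)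
      (𝓝 (Complex.I • C ψ))) :
    C.closure = C.adjoint ∧ IsSelfAdjoint C.closure ∧ IsUnitaryGroupOf C.closure U := by
  have hinner : ∀ t x y, ⟪U t x, U t y⟫_ℂ = ⟪x, y⟫_ℂ := by
    intro t x y
    have h := (Unitary.mem_iff.1 (hunit t)).1
    rw [← ContinuousLinearMap.adjoint_inner_right, ← ContinuousLinearMap.star_eq_adjoint,
      ← mul_apply_eq_comp, h, one_apply_eq_self]
  have hneg : ∀ t x, U t (U (-t) x) = x := by
    intro t x
    rw [← mul_apply_eq_comp, ← hadd, add_neg_cancel, h0, one_apply_eq_self]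
  have hinner' : ∀ t x y, ⟪x, U t y⟫_ℂ = ⟪U (-t) x, y⟫_ℂ := by
    intro t x y
    rw [← hinner t (U (-t) x) y, hneg]
  -- `C` commutes with the group on its domain
  have hcomm : ∀ t (ψ : C.domain), C ⟨U t ψ, hinv t ψ ψ.2⟩ = U t (C ψ) := by
    intro t ψ
    have h1 := hder ⟨U t ψ, hinv t ψ ψ.2⟩
    have h2 := ((U t).continuous.tendsto _).comp (hder ψ)
    have h3 : Tendsto (fun s : ℝ => (s : ℂ)⁻¹ • (U s (U t ψ) - U t ψ)) (𝓝[≠] 0)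
        (𝓝 (U t (Complex.I • C ψ))) := by
      refine h2.congr fun s => ?_
      have : U s (U t ψ) = U t (U s ψ) := by
        rw [← mul_apply_eq_comp, ← mul_apply_eq_comp, ← hadd, ← hadd, add_comm]
      simp [this]
    have h4 := tendsto_nhds_unique h1 h3
    rw [_root_.map_smul] at h4
    exact smul_right_injective E Complex.I_ne_zero h4
  have hderiv : ∀ (ψ : C.domain) t, HasDerivAt (fun s : ℝ => U s ψ) (U t (Complex.I • C ψ)) t := by
    intro ψ t
    rw [hasDerivAt_iff_tendsto_slope_zero]
    have h1 := ((U t).continuous.tendsto _).comp (hder ψ)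
    refine h1.congr fun s => ?_
    rw [← Complex.coe_smul, hadd]
    simp
  -- the adjoint is contained in the generator
  have hadj : ∀ φ χ, (φ, χ) ∈ C.adjoint.graph →
      Tendsto (fun t : ℝ => (t : ℂ)⁻¹ • (U t φ - φ)) (𝓝[≠] 0) (𝓝 (Complex.I • χ)) := by
    intro φ χ h
    rw [adjoint_graph_eq_graph_adjoint hC, Submodule.mem_adjoint_iff] at h
    have hch : Continuous fun s => U s (Complex.I • χ) := hcont _
    have hFTC : ∀ t, HasDerivAt (fun t => ∫ s in (0 : ℝ)..t, U s (Complex.I • χ))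
        (U t (Complex.I • χ)) t := fun t =>
      intervalIntegral.integral_hasDerivAt_right (hch.intervalIntegrable _ _)
        hch.stronglyMeasurable.stronglyMeasurableAtFilter hch.continuousAt
    -- The integrated equation is checked weakly against the dense domain of `C`, since
    -- differentiability of `U t φ` is not yet known; it then follows from the integral form.
    have hrep : ∀ t, U t φ = φ + ∫ s in (0 : ℝ)..t, U s (Complex.I • χ) := by
      intro t
      refine hC.eq_of_inner_right ℂ fun ψ hψ => ?_
      have hd : ∀ t, HasDerivAt (fun t : ℝ => ⟪ψ, U t φ⟫_ℂ -
          ⟪ψ, φ + ∫ s in (0 : ℝ)..t, U s (Complex.I • χ)⟫_ℂ) 0 t := by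
        intro t
        have h1 := ((hderiv ⟨ψ, hψ⟩ (-t)).scomp t (hasDerivAt_neg t)).inner ℂ
          (hasDerivAt_const t φ)
        have h2 := (hasDerivAt_const t ψ).inner ℂ ((hFTC t).const_add φ)
        have h3 := h1.sub h2
        have h4 : (fun t : ℝ => ⟪ψ, U t φ⟫_ℂ -
          ⟪ψ, φ + ∫ s in (0 : ℝ)..t, U s (Complex.I • χ)⟫_ℂ) = fun t =>
            ⟪((fun s : ℝ => U s ψ) ∘ fun t => -t) t, φ⟫_ℂ -
              ⟪ψ, φ + ∫ s in (0 : ℝ)..t, U s (Complex.I • χ)⟫_ℂ := by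
          funext t
          simp only [Function.comp, hinner' t]
        rw [h4]
        refine HasDerivAt.congr_deriv h3 ?_
        -- Invariance of the domain enters here: the adjoint relation is tested on the moved vector
        -- `U (-t) ψ`.
        have h5 := h (U (-t) ψ) (U (-t) (C ⟨ψ, hψ⟩)) (by
          rw [← hcomm (-t) ⟨ψ, hψ⟩]
          exact C.mem_graph ⟨U (-t) ψ, hinv _ _ hψ⟩)
        simp only [inner_zero_right, inner_zero_left, _root_.map_smul, neg_smul, one_smul,
          inner_neg_left, inner_smul_left, inner_smul_right, Complex.conj_I, hinner' t] at h5 ⊢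
        linear_combination Complex.I * h5
      have hc := is_const_of_deriv_eq_zero (fun s => (hd s).differentiableAt)
        (fun s => (hd s).deriv) t 0
      simp only [h0, one_apply_eq_self, intervalIntegral.integral_same, add_zero, sub_self] at hc
      exact sub_eq_zero.1 hc
    have h1 := (hFTC 0).const_add φ
    have h2 : HasDerivAt (fun t => U t φ) (U 0 (Complex.I • χ)) 0 := by
      convert h1 using 1
      funext t
      exact hrep t
    rw [hasDerivAt_iff_tendsto_slope_zero] at h2
    simp only [h0, one_apply_eq_self, zero_add] at h2
    refine h2.congr fun s => ?_
    rw [← Complex.coe_smul]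
    simp
  have hadj' : ∀ φ χ, Tendsto (fun t : ℝ => (t : ℂ)⁻¹ • (U t φ - φ)) (𝓝[≠] 0)
      (𝓝 (Complex.I • χ)) → (φ, χ) ∈ C.adjoint.graph := by
    intro φ χ h
    rw [adjoint_graph_eq_graph_adjoint hC, Submodule.mem_adjoint_iff]
    intro a b hab
    obtain ⟨a, rfl, rfl⟩ := C.mem_graph_iff.1 hab
    exact sub_eq_zero.2 (inner_eq_of_tendsto hinner h0 (hder a) h)
  have hle : C ≤ C.adjoint := le_of_le_graph fun x hx => by
    obtain ⟨a, ha, hb⟩ := C.mem_graph_iff.1 hx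
    have := hadj' _ _ (hder a)
    rwa [ha, hb] at this
  have hdense : Dense (C.adjoint.domain : Set E) := hC.mono hle.1
  have hcl : C.IsClosable := isClosable_iff_exists_closed_extension.2
    ⟨_, adjoint_isClosed hC, hle⟩
  have hbi : C.closure = C.adjoint.adjoint := by
    apply eq_of_eq_graph
    rw [← hcl.graph_closure_eq_closure_graph, adjoint_graph_eq_graph_adjoint hdense,
      adjoint_graph_eq_graph_adjoint hC, submodule_adjoint_adjoint]
  -- One inclusion is antitonicity of the adjoint applied to `C ≤ C.adjoint`; the other is symmetry
  -- of `C.adjoint`, which lies inside the generator of a unitary group.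
  have heq : C.adjoint.adjoint = C.adjoint := by
    apply le_antisymm
    · refine le_of_le_graph ?_
      rw [adjoint_graph_eq_graph_adjoint hdense, adjoint_graph_eq_graph_adjoint hC]
      intro x hx
      rw [Submodule.mem_adjoint_iff] at hx ⊢
      intro a b hab
      refine hx a b ?_
      rw [← adjoint_graph_eq_graph_adjoint hC]
      exact le_graph_of_le hle hab
    · refine IsFormalAdjoint.le_adjoint hdense fun x y => ?_
      exact inner_eq_of_tendsto hinner h0 (hadj _ _ (C.adjoint.mem_graph x))
        (hadj _ _ (C.adjoint.mem_graph y))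
  rw [heq] at hbi
  refine ⟨hbi, ?_, ?_⟩
  · rw [isSelfAdjoint_def, hbi, heq]
  · refine ⟨hunit, h0, hadd, hcont, fun ψ φ => ?_⟩
    rw [hbi]
    exact ⟨hadj ψ φ, hadj' ψ φ⟩

end Core

/-! ### Displacement operators: composition law, unitarity, strong continuity. -/

section Displacement

open MeasureTheory Filter Topology

/-- The phase `e^{i(px - qp/2)}`. -/
def phase (z : ℝ × ℝ) (x : ℝ) : ℂ := Complex.exp (Complex.I * (z.2 * x - z.1 * z.2 / 2))

theorem norm_phase (z : ℝ × ℝ) (x : ℝ) : ‖phase z x‖ = 1 := by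
  have : Complex.I * (z.2 * x - z.1 * z.2 / 2) =
      ((z.2 * x - z.1 * z.2 / 2 : ℝ) : ℂ) * Complex.I := by
    push_cast; ring
  rw [phase, this, Complex.norm_exp_ofReal_mul_I]

theorem continuous_phase : Continuous fun y : (ℝ × ℝ) × ℝ => phase y.1 y.2 := by
  unfold phase; fun_prop

theorem continuous_phase_right (z : ℝ × ℝ) : Continuous (phase z) := by
  unfold phase; fun_prop

theorem phase_zero (x : ℝ) : phase 0 x = 1 := by simp [phase]

theorem measurePreserving_sub (q : ℝ) : MeasurePreserving (fun x : ℝ => x - q) volume volume :=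
  measurePreserving_sub_right volume q

theorem ae_sub {p : ℝ → Prop} (h : ∀ᵐ x, p x) (q : ℝ) : ∀ᵐ x : ℝ, p (x - q) :=
  (measurePreserving_sub q).quasiMeasurePreserving.ae h

theorem memLp_phase_mul (z : ℝ × ℝ) (f : H) :
    MemLp (fun x => phase z x * f (x - z.1)) 2 (volume : Measure ℝ) := by
  have h := (Lp.memLp f).comp_measurePreserving (measurePreserving_sub z.1)
  refine h.of_le ((continuous_phase_right z).aestronglyMeasurable.mul h.1) (ae_of_all _ fun x => ?_)
  simp [norm_phase]

/-- The displacement operator `(D(q,p)ψ)(x) = e^{i(px - qp/2)} ψ(x - q)`, as an isometry. -/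
def displacementIsometry (z : ℝ × ℝ) : H →ₗᵢ[ℂ] H where
  toFun f := (memLp_phase_mul z f).toLp _
  map_add' f g := by
    rw [← MemLp.toLp_add]
    refine MemLp.toLp_congr _ _ ?_
    filter_upwards [ae_sub (Lp.coeFn_add f g) z.1] with x hx
    rw [hx]
    exact mul_add _ _ _
  map_smul' c f := by
    rw [RingHom.id_apply, ← MemLp.toLp_const_smul]
    refine MemLp.toLp_congr _ _ ?_
    filter_upwards [ae_sub (Lp.coeFn_smul c f) z.1] with x hx
    simp [hx, mul_left_comm]
  norm_map' f := by
    change ‖(memLp_phase_mul z f).toLp _‖ = ‖f‖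
    rw [Lp.norm_toLp, Lp.norm_def]
    congr 1
    rw [← eLpNorm_comp_measurePreserving (Lp.memLp f).1 (measurePreserving_sub z.1)]
    refine eLpNorm_congr_norm_ae (ae_of_all _ fun x => ?_)
    simp [norm_phase]

/-- The displacement operator `(D(q,p)ψ)(x) = e^{i(px - qp/2)} ψ(x - q)`. -/
def displacement (z : ℝ × ℝ) : H →L[ℂ] H := (displacementIsometry z).toContinuousLinearMap

theorem displacement_coeFn (z : ℝ × ℝ) (f : H) :
    displacement z f =ᵐ[volume] fun x => phase z x * f (x - z.1) :=
  MemLp.coeFn_toLp (memLp_phase_mul z f)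

theorem norm_displacement (z : ℝ × ℝ) (f : H) : ‖displacement z f‖ = ‖f‖ :=
  (displacementIsometry z).norm_map f

theorem displacement_zero : displacement 0 = 1 := by
  ext1 f
  refine Lp.ext ?_
  filter_upwards [displacement_coeFn 0 f] with x hx
  simp [hx, phase_zero]

/-- The multiplier of the Weyl operators. -/
def weylMultiplier (z w : ℝ × ℝ) : ℂ :=
  Complex.exp (Complex.I * ((z.1 * w.2 - z.2 * w.1) / 2))

theorem displacement_add (z w : ℝ × ℝ) :
    displacement (z + w) = weylMultiplier z w • (displacement z * displacement w) := by
  ext1 f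
  refine Lp.ext ?_
  rw [smul_apply, mul_apply_eq_comp]
  filter_upwards [displacement_coeFn (z + w) f, displacement_coeFn z (displacement w f),
    ae_sub (displacement_coeFn w f) z.1,
    Lp.coeFn_smul (weylMultiplier z w) (displacement z (displacement w f))] with x h1 h2 h3 h4
  rw [h1, h4, Pi.smul_apply, h2, h3, smul_eq_mul, ← mul_assoc, ← mul_assoc]
  have e : phase (z + w) x = weylMultiplier z w * phase z x * phase w (x - z.1) := by
    simp only [phase, weylMultiplier, ← Complex.exp_add]
    congr 1
    simp only [Prod.fst_add, Prod.snd_add]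
    push_cast
    ring
  rw [e, Prod.fst_add, sub_sub]

/-- The symplectic form vanishes on a line, so there displacements compose without a phase. -/
theorem weylMultiplier_of_parallel {z w : ℝ × ℝ} (h : z.1 * w.2 = z.2 * w.1) :
    weylMultiplier z w = 1 := by
  have h' : (z.1 : ℂ) * w.2 = z.2 * w.1 := by exact_mod_cast h
  simp [weylMultiplier, h']

theorem norm_weylMultiplier (z w : ℝ × ℝ) : ‖weylMultiplier z w‖ = 1 := by
  have : Complex.I * ((z.1 * w.2 - z.2 * w.1) / 2) =
    (((z.1 * w.2 - z.2 * w.1) / 2 : ℝ) : ℂ) * Complex.I := by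
    push_cast; ring
  rw [weylMultiplier, this, Complex.norm_exp_ofReal_mul_I]

theorem displacement_mul_neg (z : ℝ × ℝ) : displacement z * displacement (-z) = 1 := by
  have h := displacement_add z (-z)
  rw [add_neg_cancel, displacement_zero, weylMultiplier_of_parallel (by simp [mul_comm]),
    one_smul] at h
  exact h.symm

theorem displacement_mem_unitary (z : ℝ × ℝ) : displacement z ∈ unitary (H →L[ℂ] H) := by
  have h1 : star (displacement z) * displacement z = 1 := by
    ext1 f
    refine ext_inner_left ℂ fun g => ?_
    rw [mul_apply_eq_comp, ContinuousLinearMap.star_eq_adjoint,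
      ContinuousLinearMap.adjoint_inner_right]
    exact (displacementIsometry z).inner_map_map g f
  refine Unitary.mem_iff.2 ⟨h1, ?_⟩
  have h2 : star (displacement z) = displacement (-z) := by
    rw [← mul_one (star _), ← displacement_mul_neg z, ← mul_assoc, h1, one_mul]
  rw [h2, displacement_mul_neg]

/-- Dominated convergence in `L²(ℝ)`, with a square-integrable majorant. -/
theorem tendsto_of_dominated {ι : Type*} {l : Filter ι} [l.IsCountablyGenerated]
    {F : ι → H} {G : H} {f : ι → ℝ → ℂ} {g : ℝ → ℂ} {b : ℝ → ℝ}
    (hF : ∀ i, F i =ᵐ[volume] f i) (hG : G =ᵐ[volume] g)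
    (hb : MemLp b 2 (volume : Measure ℝ))
    (hfb : ∀ᶠ i in l, ∀ x, ‖f i x - g x‖ ≤ b x)
    (hlim : ∀ x, Tendsto (fun i => f i x) l (𝓝 (g x))) :
    Tendsto F l (𝓝 G) := by
  rw [Lp.tendsto_Lp_iff_tendsto_eLpNorm']
  have hae : ∀ i, ⇑(F i) - ⇑G =ᵐ[volume] fun x => f i x - g x := fun i => (hF i).sub hG
  have hmeas : ∀ i, AEStronglyMeasurable (fun x => f i x - g x) (volume : Measure ℝ) := fun i =>
    (((Lp.aestronglyMeasurable (F i)).sub (Lp.aestronglyMeasurable G)).congr (hae i))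
  have h1 : Tendsto (fun i => ∫⁻ x, ‖f i x - g x‖ₑ ^ (2 : ℝ)) l (𝓝 (∫⁻ _ : ℝ, 0)) := by
    refine tendsto_lintegral_filter_of_dominated_convergence' (fun x => ‖b x‖ₑ ^ (2 : ℝ))
      (Eventually.of_forall fun i => (hmeas i).enorm.pow_const _) ?_ ?_ ?_
    · filter_upwards [hfb] with i hi
      refine ae_of_all _ fun x => ?_
      gcongr
      exact enorm_le_iff_norm_le.2 ((hi x).trans (le_abs_self _))
    · have := lintegral_rpow_enorm_lt_top_of_eLpNorm_lt_top (by simp) (by simp) hb.eLpNorm_lt_top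
      simpa using this.ne
    · refine ae_of_all _ fun x => ?_
      have h2 : Tendsto (fun i => ‖f i x - g x‖ₑ) l (𝓝 0) := by
        have := ((hlim x).sub_const (g x)).enorm
        simpa using this
      have h3 := h2.ennrpow_const (2 : ℝ)
      simpa using h3
  simp only [lintegral_zero] at h1
  have h4 := h1.ennrpow_const (1 / 2 : ℝ)
  simp only [one_div, ENNReal.zero_rpow_of_pos (show (0 : ℝ) < 2⁻¹ by norm_num)] at h4
  refine h4.congr fun i => ?_
  rw [eLpNorm_congr_ae (hae i), eLpNorm_eq_lintegral_rpow_enorm_toReal (by simp) (by simp)]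
  simp

/-- Each derivative is a constant times the phase, hence bounded. Multiplication by the phase
therefore preserves the Schwartz space. -/
theorem hasTemperateGrowth_phase (z : ℝ × ℝ) : (phase z).HasTemperateGrowth := by
  have hd : ∀ x, HasDerivAt (phase z) (Complex.I * z.2 * phase z x) x := by
    intro x
    have h1 : HasDerivAt (fun x : ℝ => (x : ℂ)) 1 x := Complex.ofRealCLM.hasDerivAt
    have := (((h1.const_mul (z.2 : ℂ)).sub_const ((z.1 : ℂ) * z.2 / 2)).const_mul Complex.I).cexp
    refine this.congr_deriv ?_
    rw [phase]; ring
  have hi : ∀ n, iteratedDeriv n (phase z) = fun x => (Complex.I * z.2) ^ n * phase z x := by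
    intro n
    induction n with
    | zero => simp
    | succ n ih =>
      rw [iteratedDeriv_succ, ih]
      funext x
      rw [((hd x).const_mul _).deriv]
      ring
  refine ⟨?_, fun n => ⟨0, ‖(Complex.I * z.2) ^ n‖, fun x => ?_⟩⟩
  · have h : ContDiff ℝ ∞ fun x : ℝ => (x : ℂ) := Complex.ofRealCLM.contDiff
    exact (contDiff_const.mul ((contDiff_const.mul h).sub contDiff_const)).cexp
  · rw [norm_iteratedFDeriv_eq_norm_iteratedDeriv, hi]
    simp [norm_phase]

/-- The displacement operator on the Schwartz space. -/
def schwartzDisplacement (z : ℝ × ℝ) (f : 𝓢(ℝ, ℂ)) : 𝓢(ℝ, ℂ) :=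
  SchwartzMap.smulLeftCLM ℂ (phase z) (f.compSubConstCLM ℂ z.1)

theorem schwartzDisplacement_apply (z : ℝ × ℝ) (f : 𝓢(ℝ, ℂ)) (x : ℝ) :
    schwartzDisplacement z f x = phase z x * f (x - z.1) := by
  rw [schwartzDisplacement, SchwartzMap.smulLeftCLM_apply_apply (hasTemperateGrowth_phase z)]
  rfl

theorem incl_coeFn (f : 𝓢(ℝ, ℂ)) : incl f =ᵐ[volume] f := SchwartzMap.coeFn_toLp f 2 volume

theorem displacement_incl_coeFn (z : ℝ × ℝ) (f : 𝓢(ℝ, ℂ)) :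
    displacement z (incl f) =ᵐ[volume] fun x => phase z x * f (x - z.1) := by
  filter_upwards [displacement_coeFn z (incl f), ae_sub (incl_coeFn f) z.1] with x h1 h2
  rw [h1, h2]

/-- Supplies the invariance of the Schwartz domain that the self-adjointness criterion needs. -/
theorem displacement_incl (z : ℝ × ℝ) (f : 𝓢(ℝ, ℂ)) :
    displacement z (incl f) = incl (schwartzDisplacement z f) := by
  refine Lp.ext ?_
  filter_upwards [displacement_incl_coeFn z f, incl_coeFn (schwartzDisplacement z f)] with x h1 h2
  rw [h1, h2, schwartzDisplacement_apply]

theorem denseRange_incl : DenseRange incl :=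
  SchwartzMap.denseRange_toLpCLM (F := ℂ) (E := ℝ) (p := 2) (by simp) (μ := volume)

theorem memLp_majorant (c : ℝ) :
    MemLp (fun x : ℝ => c * (1 + |x|)⁻¹) 2 (volume : Measure ℝ) := by
  refine MemLp.const_mul ?_ c
  have hc : Continuous fun x : ℝ => (1 + |x|)⁻¹ :=
    (continuous_const.add continuous_abs).inv₀ fun x => (by positivity : (0 : ℝ) < 1 + |x|).ne'
  rw [memLp_two_iff_integrable_sq hc.aestronglyMeasurable]
  have := integrable_one_add_norm (E := ℝ) (μ := volume) (r := 2) (by simp)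
  refine this.congr (ae_of_all _ fun x => ?_)
  simp only [Real.norm_eq_abs]
  rw [Real.rpow_neg (by positivity), inv_pow]
  norm_num

/-- Translates of a Schwartz function by bounded amounts have a common majorant. -/
theorem exists_majorant (f : 𝓢(ℝ, ℂ)) (r : ℝ) (hr : 0 ≤ r) :
    ∃ c, ∀ q x : ℝ, |q| ≤ r → ‖f (x - q)‖ ≤ c * (1 + |x|)⁻¹ := by
  obtain ⟨C₀, h0⟩ := f.decay 0 0
  obtain ⟨C₁, h1⟩ := f.decay 1 0
  -- `C₀` bounds `‖f y‖` and `C₁` bounds `|y| ‖f y‖`; the factor `1 + r` comes from `1 + |x| ≤ (1 +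
  -- r)(1 + |x - q|)`.
  refine ⟨(1 + r) * (C₀ + C₁), fun q x hq => ?_⟩
  have h0' := h0.2 (x - q)
  have h1' := h1.2 (x - q)
  simp only [pow_zero, one_mul, pow_one, norm_iteratedFDeriv_zero, Real.norm_eq_abs] at h0' h1'
  rw [← div_eq_mul_inv, le_div_iff₀ (by positivity)]
  have h2 : |x| ≤ |x - q| + r := by
    have := abs_add_le (x - q) q
    rw [sub_add_cancel] at this
    linarith
  have h3 : 1 + |x| ≤ (1 + r) * (1 + |x - q|) := by nlinarith [abs_nonneg (x - q)]
  calc ‖f (x - q)‖ * (1 + |x|) ≤ ‖f (x - q)‖ * ((1 + r) * (1 + |x - q|)) := by gcongr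
    _ = (1 + r) * (‖f (x - q)‖ + |x - q| * ‖f (x - q)‖) := by ring
    _ ≤ _ := by gcongr

/-- Dominated convergence settles Schwartz vectors; an `ε/3` argument extends this to all vectors
because displacements are isometries. -/
theorem continuous_displacement (ψ : H) : Continuous fun z => displacement z ψ := by
  have key : ∀ f : 𝓢(ℝ, ℂ), Continuous fun z => displacement z (incl f) := by
    intro f
    refine continuous_iff_continuousAt.2 fun z₀ => ?_
    obtain ⟨c, hc⟩ := exists_majorant f (|z₀.1| + 1) (by positivity)
    refine tendsto_of_dominated (b := fun x => (c + c) * (1 + |x|)⁻¹)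
      (fun z => displacement_incl_coeFn z f)
      (displacement_incl_coeFn z₀ f) (memLp_majorant (c + c)) ?_ fun x => ?_
    · have h : ∀ᶠ z : ℝ × ℝ in 𝓝 z₀, |z.1| < |z₀.1| + 1 :=
        (continuous_fst.abs.continuousAt (x := z₀)).eventually_lt_const (lt_add_one _)
      filter_upwards [h] with z hz x
      refine (norm_sub_le _ _).trans ?_
      rw [norm_mul, norm_mul, norm_phase, norm_phase, one_mul, one_mul, add_mul]
      exact add_le_add (hc _ _ hz.le) (hc _ _ (by linarith))
    · have : Continuous fun z : ℝ × ℝ => phase z x * f (x - z.1) :=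
        (continuous_phase.comp (by fun_prop : Continuous fun z : ℝ × ℝ => (z, x))).mul
          (f.continuous.comp (by fun_prop))
      exact this.tendsto z₀
  refine continuous_iff_continuousAt.2 fun z₀ => Metric.tendsto_nhds.2 fun ε hε => ?_
  obtain ⟨f, hf⟩ := Metric.denseRange_iff.1 denseRange_incl ψ (ε / 3) (by positivity)
  filter_upwards [Metric.tendsto_nhds.1 ((key f).tendsto z₀) (ε / 3) (by positivity)] with z hz
  have e : ∀ z, dist (displacement z ψ) (displacement z (incl f)) < ε / 3 := by
    intro z
    rw [dist_eq_norm, ← map_sub, norm_displacement, ← dist_eq_norm]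
    exact hf
  have h1 := dist_triangle4 (displacement z ψ) (displacement z (incl f))
    (displacement z₀ (incl f)) (displacement z₀ ψ)
  have h2 := e z
  have h3 := e z₀
  rw [dist_comm] at h3
  linarith

end Displacement

/-! ### Self-adjointness of `cQ + sP` and the groups generated. -/

section Generators

open MeasureTheory Filter Topology

theorem incl_mem_domain (T : 𝓢(ℝ, ℂ) →ₗ[ℂ] 𝓢(ℝ, ℂ)) (f : 𝓢(ℝ, ℂ)) :
    incl f ∈ (schwartzOp T).domain := ⟨f, rfl⟩

theorem schwartzOp_apply (T : 𝓢(ℝ, ℂ) →ₗ[ℂ] 𝓢(ℝ, ℂ)) (f : 𝓢(ℝ, ℂ)) :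
    schwartzOp T ⟨incl f, incl_mem_domain T f⟩ = incl (T f) := by
  change incl (T ((LinearEquiv.ofInjective incl incl_injective).symm ⟨incl f, _⟩)) = _
  congr 2
  exact (LinearEquiv.ofInjective incl incl_injective).symm_apply_apply f

theorem dense_domain_schwartzOp (T : 𝓢(ℝ, ℂ) →ₗ[ℂ] 𝓢(ℝ, ℂ)) :
    Dense ((schwartzOp T).domain : Set H) := denseRange_incl

/-- `c x - i s d/dx` on the Schwartz space. -/
def linComb (c s : ℝ) : 𝓢(ℝ, ℂ) →ₗ[ℂ] 𝓢(ℝ, ℂ) := (c : ℂ) • mulX + (s : ℂ) • negIDeriv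

theorem linComb_apply (c s : ℝ) (f : 𝓢(ℝ, ℂ)) (x : ℝ) :
    linComb c s f x = c * (x * f x) - s * Complex.I * deriv f x := by
  change c * (mulX f x) + s * (-Complex.I * SchwartzMap.derivCLM ℂ ℂ f x) = _
  rw [mulX_apply, SchwartzMap.derivCLM_apply]
  ring

/-- The direction of the one-parameter group generated by `c Q + s P`. -/
def ray (c s t : ℝ) : ℝ × ℝ := (-(s * t), c * t)

theorem hasDerivAt_phase_ray_mul (c s x : ℝ) (f : 𝓢(ℝ, ℂ)) (t : ℝ) :
    HasDerivAt (fun t => phase (ray c s t) x * f (x - (ray c s t).1))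
      (phase (ray c s t) x * (Complex.I * linComb c s f (x - (ray c s t).1))) t := by
  have h1 : HasDerivAt (fun t : ℝ => (t : ℂ)) 1 t := Complex.ofRealCLM.hasDerivAt
  have h2 : HasDerivAt (fun t : ℝ => phase (ray c s t) x)
      (phase (ray c s t) x * (Complex.I * (c * x + s * c * t))) t := by
    have h3 := (((h1.const_mul (c * x : ℂ)).add ((h1.pow 2).const_mul (s * c / 2 : ℂ))).const_mul
      Complex.I).cexp
    have e : ∀ t : ℝ, phase (ray c s t) x =
        Complex.exp (Complex.I * (c * x * t + s * c / 2 * (t : ℂ) ^ 2)) := by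
      intro t
      simp only [phase, ray]
      congr 1
      push_cast
      ring
    rw [funext e, e t]
    refine h3.congr_deriv ?_
    simp only [Pi.add_apply, Pi.pow_apply]
    push_cast
    ring
  have h4 : HasDerivAt (fun t : ℝ => f (x - (ray c s t).1))
      (s * deriv f (x - (ray c s t).1)) t := by
    have h5 : HasDerivAt (fun t : ℝ => x - (ray c s t).1) s t := by
      have := ((((hasDerivAt_id t).const_mul s).neg).const_sub x)
      refine this.congr_deriv ?_
      simp
    have h6 := (f.differentiableAt (x := x - (ray c s t).1)).hasDerivAt
    exact (h6.scomp t h5).congr_deriv (Complex.coe_smul _ _).symm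
  refine (h2.mul h4).congr_deriv ?_
  rw [linComb_apply]
  -- The quadratic term of the phase contributes exactly the shift that turns `x` into the
  -- translated argument.
  have : ((x - (ray c s t).1 : ℝ) : ℂ) = x + s * t := by simp [ray]
  rw [this]
  linear_combination (phase (ray c s t) x * s * deriv f (x - (ray c s t).1)) * Complex.I_sq

theorem ray_zero (c s : ℝ) : ray c s 0 = 0 := by simp [ray]

theorem displacement_ray_add (c s t u : ℝ) :
    displacement (ray c s (t + u)) = displacement (ray c s t) * displacement (ray c s u) := by
  have : ray c s (t + u) = ray c s t + ray c s u := by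
    ext <;> simp [ray] <;> ring
  rw [this, displacement_add, weylMultiplier_of_parallel (by simp only [ray]; ring), one_smul]

/-- The pointwise derivative is bounded for `|t| ≤ 1` by a square-integrable majorant, and the mean
value inequality passes this bound to the difference quotients. -/
theorem tendsto_displacement_ray (c s : ℝ) (f : 𝓢(ℝ, ℂ)) :
    Tendsto (fun t : ℝ => (t : ℂ)⁻¹ • (displacement (ray c s t) (incl f) - incl f)) (𝓝[≠] 0)
      (𝓝 (Complex.I • incl (linComb c s f))) := by
  obtain ⟨K, hK⟩ := exists_majorant (linComb c s f) |s| (abs_nonneg s)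
  refine tendsto_of_dominated
    (f := fun t x => (t : ℂ)⁻¹ * (phase (ray c s t) x * f (x - (ray c s t).1) - f x))
    (g := fun x => Complex.I * linComb c s f x) (b := fun x => (K + K) * (1 + |x|)⁻¹)
    (fun t => ?_) ?_ (memLp_majorant _) ?_ fun x => ?_
  · filter_upwards [Lp.coeFn_smul (t : ℂ)⁻¹ (displacement (ray c s t) (incl f) - incl f),
      Lp.coeFn_sub (displacement (ray c s t) (incl f)) (incl f), incl_coeFn f,
      displacement_incl_coeFn (ray c s t) f] with x h1 h2 h3 h4
    rw [h1, Pi.smul_apply, h2, Pi.sub_apply, h3, h4, smul_eq_mul]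
  · filter_upwards [Lp.coeFn_smul Complex.I (incl (linComb c s f)),
      incl_coeFn (linComb c s f)] with x h1 h2
    rw [h1, Pi.smul_apply, h2, smul_eq_mul]
  · have hball : Metric.closedBall (0 : ℝ) 1 ∈ 𝓝[≠] (0 : ℝ) :=
      mem_nhdsWithin_of_mem_nhds (Metric.closedBall_mem_nhds 0 one_pos)
    filter_upwards [hball] with t ht x
    refine (norm_sub_le _ _).trans ?_
    rw [add_mul]
    have hbound : ∀ u ∈ Metric.closedBall (0 : ℝ) 1,
        ‖phase (ray c s u) x * (Complex.I * linComb c s f (x - (ray c s u).1))‖ ≤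
          K * (1 + |x|)⁻¹ := by
      intro u hu
      rw [norm_mul, norm_phase, one_mul, norm_mul, Complex.norm_I, one_mul]
      refine hK _ _ ?_
      simp only [ray, abs_neg, abs_mul]
      rw [mem_closedBall_zero_iff, Real.norm_eq_abs] at hu
      exact mul_le_of_le_one_right (abs_nonneg s) hu
    refine add_le_add ?_ ?_
    · have h1 := (convex_closedBall (0 : ℝ) 1).norm_image_sub_le_of_norm_hasDerivWithin_le
        (fun u _ => (hasDerivAt_phase_ray_mul c s x f u).hasDerivWithinAt) hbound
        (Metric.mem_closedBall_self zero_le_one) ht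
      simp only [ray_zero, phase_zero, Prod.fst_zero, sub_zero, one_mul] at h1
      rw [norm_mul, norm_inv, Complex.norm_real]
      -- The ball contains `t = 0`, where the quotient is zero by the convention `0⁻¹ = 0`.
      rcases eq_or_ne t 0 with rfl | h0
      · have := (norm_nonneg _).trans (hbound 0 (Metric.mem_closedBall_self zero_le_one))
        simpa using this
      · rw [inv_mul_le_iff₀ (norm_pos_iff.2 h0), mul_comm ‖t‖]
        exact h1
    · have := hbound 0 (Metric.mem_closedBall_self zero_le_one)
      simpa only [ray_zero, phase_zero, Prod.fst_zero, sub_zero, one_mul] using this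
  · have h := hasDerivAt_phase_ray_mul c s x f 0
    rw [hasDerivAt_iff_tendsto_slope_zero] at h
    simp only [ray_zero, phase_zero, Prod.fst_zero, sub_zero, one_mul, zero_add] at h
    refine h.congr fun t => ?_
    rw [← Complex.coe_smul]
    simp

/-- `c Q + s P` is essentially self-adjoint on the Schwartz space and generates displacements. -/
theorem schwartzOp_linComb (c s : ℝ) :
    (schwartzOp (linComb c s)).closure = (schwartzOp (linComb c s)).adjoint ∧
    IsSelfAdjoint (schwartzOp (linComb c s)).closure ∧
    IsUnitaryGroupOf (schwartzOp (linComb c s)).closure fun t => displacement (ray c s t) := by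
  refine isSelfAdjoint_closure_of_invariant (dense_domain_schwartzOp _)
    (fun t => displacement_mem_unitary _) ?_ (displacement_ray_add c s) (fun ψ => ?_) ?_ ?_
  · simp only [ray_zero, displacement_zero]
  · exact (continuous_displacement ψ).comp (by unfold ray; fun_prop)
  · rintro t _ ⟨f, rfl⟩
    rw [displacement_incl]
    exact incl_mem_domain _ _
  · rintro ⟨_, f, rfl⟩
    have := tendsto_displacement_ray c s f
    rwa [← schwartzOp_apply] at this

theorem expI_linComb (c s t : ℝ) :
    expI (schwartzOp (linComb c s)).closure t = displacement (ray c s t) := by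
  obtain ⟨-, h1, h2⟩ := schwartzOp_linComb c s
  rw [expI_eq h1.dense_domain h2]

theorem position_eq : position = (schwartzOp (linComb 1 0)).closure := by
  simp [position, linComb]

theorem momentum_eq : momentum = (schwartzOp (linComb 0 1)).closure := by
  simp [momentum, linComb]

theorem weyl_eq_displacement (z : ℝ × ℝ) : weyl z = displacement z := by
  have h : z = ray 0 1 (-z.1) + ray 1 0 z.2 := by ext <;> simp [ray]
  conv_rhs => rw [h]
  rw [weyl, position_eq, momentum_eq, expI_linComb, expI_linComb, displacement_add]
  congr 1
  simp [weylMultiplier, ray]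

/-! ### Identification of the quadrature with `cos θ Q + sin θ P`. -/

section Quadrature

open LinearPMap

/-- A symmetric extension of an essentially self-adjoint operator has the same closure. -/
theorem closure_eq_of_symmetric_extension {E : Type*} [NormedAddCommGroup E]
    [InnerProductSpace ℂ E] [CompleteSpace E] {B C : E →ₗ.[ℂ] E}
    (hC : Dense (C.domain : Set E)) (hCadj : C.closure = C.adjoint) (hle : C ≤ B)
    (hB : B.IsFormalAdjoint B) : B.closure = C.closure := by
  -- The chain is `C ≤ B ≤ C.adjoint = C.closure`, the middle step being symmetry of `B` tested on
  -- the domain of `C`.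
  have hBC : B ≤ C.closure := by
    rw [hCadj]
    refine IsFormalAdjoint.le_adjoint hC fun x y => ?_
    have := hB ⟨x, hle.1 x.2⟩ y
    rwa [← hle.2 (x := x) (y := ⟨x, hle.1 x.2⟩) rfl] at this
  have hclosed : C.closure.IsClosed := by
    rw [hCadj]; exact adjoint_isClosed hC
  have hclos : B.IsClosable := isClosable_iff_exists_closed_extension.2 ⟨_, hclosed, hBC⟩
  refine le_antisymm (le_of_le_graph ?_) (hclos.closure_mono hle)
  rw [← hclos.graph_closure_eq_closure_graph]
  exact Submodule.topologicalClosure_minimal _ (le_graph_of_le hBC) hclosed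

theorem closure_schwartzOp_apply (T : 𝓢(ℝ, ℂ) →ₗ[ℂ] 𝓢(ℝ, ℂ)) (f : 𝓢(ℝ, ℂ))
    (hf : incl f ∈ (schwartzOp T).closure.domain) :
    (schwartzOp T).closure ⟨incl f, hf⟩ = incl (T f) := by
  rw [← schwartzOp_apply]
  exact ((schwartzOp T).le_closure.2 rfl).symm

theorem incl_mem_annihilation_domain (f : 𝓢(ℝ, ℂ)) : incl f ∈ annihilation.domain :=
  ⟨(schwartzOp mulX).le_closure.1 ⟨f, rfl⟩, (schwartzOp negIDeriv).le_closure.1 ⟨f, rfl⟩⟩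

theorem dense_annihilation_domain : Dense (annihilation.domain : Set H) :=
  (dense_domain_schwartzOp mulX).mono <| by
    rintro _ ⟨f, rfl⟩
    exact incl_mem_annihilation_domain f

theorem annihilation_apply (x : annihilation.domain) :
    annihilation x = ((√2 : ℝ) : ℂ)⁻¹ •
      (position ⟨x, x.2.1⟩ + Complex.I • momentum ⟨x, x.2.2⟩) := rfl

theorem position_incl (f : 𝓢(ℝ, ℂ)) (hf : incl f ∈ position.domain) :
    position ⟨incl f, hf⟩ = incl (mulX f) := closure_schwartzOp_apply _ _ _

theorem momentum_incl (f : 𝓢(ℝ, ℂ)) (hf : incl f ∈ momentum.domain) :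
    momentum ⟨incl f, hf⟩ = incl (negIDeriv f) := closure_schwartzOp_apply _ _ _

theorem annihilation_incl (f : 𝓢(ℝ, ℂ)) :
    annihilation ⟨incl f, incl_mem_annihilation_domain f⟩ =
      ((√2 : ℝ) : ℂ)⁻¹ • (incl (mulX f) + Complex.I • incl (negIDeriv f)) := by
  rw [annihilation_apply, position_incl, momentum_incl]

/-- Shows that `a*` acts on Schwartz vectors as `(Q - iP)/√2`. The test vector ranges over the full
domain of `a`, so symmetry of the closed operators `Q` and `P` is used. -/
theorem inner_adjoint_annihilation (f : 𝓢(ℝ, ℂ)) (x : annihilation.domain) :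
    ⟪((√2 : ℝ) : ℂ)⁻¹ • (incl (mulX f) - Complex.I • incl (negIDeriv f)), (x : H)⟫_ℂ =
      ⟪incl f, annihilation x⟫_ℂ := by
  have sym : ∀ {A : H →ₗ.[ℂ] H}, IsSelfAdjoint A →
      ∀ x y : A.domain, ⟪A x, y⟫_ℂ = ⟪(x : H), A y⟫_ℂ := by
    intro A hA
    have := adjoint_isFormalAdjoint hA.dense_domain
    rwa [isSelfAdjoint_def.1 hA] at this
  have hq : IsSelfAdjoint position := position_eq ▸ (schwartzOp_linComb 1 0).2.1
  have hp : IsSelfAdjoint momentum := momentum_eq ▸ (schwartzOp_linComb 0 1).2.1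
  have h1 := sym hq ⟨incl f, (incl_mem_annihilation_domain f).1⟩ ⟨x, x.2.1⟩
  have h2 := sym hp ⟨incl f, (incl_mem_annihilation_domain f).2⟩ ⟨x, x.2.2⟩
  rw [position_incl] at h1
  rw [momentum_incl] at h2
  rw [annihilation_apply]
  simp only [inner_smul_left, inner_smul_right, inner_sub_left, inner_add_right, h1, h2, map_inv₀,
    Complex.conj_ofReal, Complex.conj_I]
  ring

theorem incl_mem_adjoint_annihilation_domain (f : 𝓢(ℝ, ℂ)) :
    incl f ∈ annihilation.adjoint.domain :=
  mem_adjoint_domain_of_exists _ ⟨_, inner_adjoint_annihilation f⟩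

theorem adjoint_annihilation_incl (f : 𝓢(ℝ, ℂ)) :
    annihilation.adjoint ⟨incl f, incl_mem_adjoint_annihilation_domain f⟩ =
      ((√2 : ℝ) : ℂ)⁻¹ • (incl (mulX f) - Complex.I • incl (negIDeriv f)) :=
  adjoint_apply_eq dense_annihilation_domain _ (inner_adjoint_annihilation f)

/-- The defining expression lives on the intersection of the domains of `a*` and `a`. It is
symmetric there, as conjugation swaps both the operators and their coefficients, and it extends `cos
θ Q + sin θ P` on Schwartz functions, so essential self-adjointness fixes its closure. -/
theorem quadrature_eq (θ : ℝ) :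
    quadrature θ = (schwartzOp (linComb (Real.cos θ) (Real.sin θ))).closure := by
  set B : H →ₗ.[ℂ] H := ((√2 : ℝ) : ℂ)⁻¹ • (Complex.exp (Complex.I * θ) • annihilation.adjoint +
    Complex.exp (-(Complex.I * θ)) • annihilation)
  have hB : ∀ x : B.domain, B x = ((√2 : ℝ) : ℂ)⁻¹ •
      (Complex.exp (Complex.I * θ) • annihilation.adjoint ⟨x, x.2.1⟩ +
        Complex.exp (-(Complex.I * θ)) • annihilation ⟨x, x.2.2⟩) := fun x => rfl
  have hsqrt : ((√2 : ℝ) : ℂ)⁻¹ * ((√2 : ℝ) : ℂ)⁻¹ = 1 / 2 := by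
    rw [← mul_inv, ← Complex.ofReal_mul, Real.mul_self_sqrt (by norm_num)]
    norm_num
  refine closure_eq_of_symmetric_extension (dense_domain_schwartzOp _)
    (schwartzOp_linComb _ _).1 ⟨?_, ?_⟩ fun x y => ?_
  · rintro _ ⟨f, rfl⟩
    exact ⟨incl_mem_adjoint_annihilation_domain f, incl_mem_annihilation_domain f⟩
  · rintro ⟨_, f, rfl⟩ ⟨y, hy⟩ hxy
    obtain rfl : incl f = y := hxy
    change schwartzOp _ ⟨incl f, incl_mem_domain _ f⟩ = B _
    rw [schwartzOp_apply, hB, adjoint_annihilation_incl, annihilation_incl]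
    have e1 : incl (linComb (Real.cos θ) (Real.sin θ) f) =
        (Real.cos θ : ℂ) • incl (mulX f) + (Real.sin θ : ℂ) • incl (negIDeriv f) := by
      rw [linComb, LinearMap.add_apply, LinearMap.smul_apply, LinearMap.smul_apply,
        _root_.map_add, _root_.map_smul, _root_.map_smul]
    have hc : Complex.exp (Complex.I * θ) = Real.cos θ + Real.sin θ * Complex.I := by
      rw [mul_comm, Complex.exp_mul_I]; simp
    have hs : Complex.exp (-(Complex.I * θ)) = Real.cos θ - Real.sin θ * Complex.I := by
      rw [mul_comm, ← neg_mul, Complex.exp_mul_I]; simp [sub_eq_add_neg]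
    rw [e1, hc, hs]
    generalize ((Real.cos θ : ℝ) : ℂ) = c
    generalize ((Real.sin θ : ℝ) : ℂ) = s
    match_scalars
    · linear_combination (-2 * c) * hsqrt
    · linear_combination (2 * s * Complex.I ^ 2) * hsqrt + s * Complex.I_sq
  · have h1 := adjoint_isFormalAdjoint dense_annihilation_domain ⟨x, x.2.1⟩ ⟨y, y.2.2⟩
    have h2 := (adjoint_isFormalAdjoint dense_annihilation_domain).symm ⟨x, x.2.2⟩ ⟨y, y.2.1⟩
    rw [hB, hB]
    have c1 : (starRingEnd ℂ) (Complex.exp (Complex.I * θ)) = Complex.exp (-(Complex.I * θ)) := by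
      rw [← Complex.exp_conj]; simp
    have c2 : (starRingEnd ℂ) (Complex.exp (-(Complex.I * θ))) = Complex.exp (Complex.I * θ) := by
      rw [← c1, Complex.conj_conj]
    simp only [inner_smul_left, inner_smul_right, inner_add_left, inner_add_right, map_inv₀,
      Complex.conj_ofReal, c1, c2] at h1 h2 ⊢
    rw [h1, h2]
    ring

end Quadrature

end Generators

/-! ### Irreducibility of the displacements. -/

section Irreducible

open MeasureTheory Filter Topology
open scoped FourierTransform

/-- The Fourier transform is injective on integrable functions. -/
theorem ae_eq_zero_of_fourier_eq_zero {h : ℝ → ℂ} (hh : Integrable h)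
    (h0 : ∀ ξ : ℝ, 𝓕 h ξ = 0) : h =ᵐ[volume] 0 := by
  refine ae_eq_zero_of_integral_contDiff_smul_eq_zero hh.locallyIntegrable fun g hg hgc => ?_
  have hg₁ : HasCompactSupport (Complex.ofRealCLM ∘ g) := hgc.comp_left rfl
  have hg₂ : ContDiff ℝ ∞ (Complex.ofRealCLM ∘ g) := by fun_prop
  -- The test function is written as the Fourier transform of a Schwartz function `K`, and the
  -- transform is then moved onto `h`.
  set G : 𝓢(ℝ, ℂ) := hg₁.toSchwartzMap hg₂
  set K : 𝓢(ℝ, ℂ) := 𝓕⁻ G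
  have hK : 𝓕 K = G := FourierTransform.fourier_fourierInv_eq G
  have h1 := VectorFourier.integral_fourierIntegral_smul_eq_flip (L := innerₗ ℝ) (μ := volume)
    (ν := volume) Real.continuous_fourierChar continuous_inner hh K.integrable
  have h2 : ∀ x, VectorFourier.fourierIntegral Real.fourierChar volume (innerₗ ℝ).flip K x =
      (g x : ℂ) := by
    intro x
    rw [flip_innerₗ]
    change 𝓕 (K : ℝ → ℂ) x = _
    rw [← SchwartzMap.fourier_coe, hK]
    rfl
  have h3 : ∀ x, VectorFourier.fourierIntegral Real.fourierChar volume (innerₗ ℝ) h x = 0 := h0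
  simp only [h2, h3, zero_smul, integral_zero] at h1
  rw [h1]
  refine integral_congr_ae (ae_of_all _ fun x => ?_)
  simp [mul_comm]

/-- Matrix elements of all displacements vanish only for zero vectors. -/
theorem eq_zero_of_inner_displacement_eq_zero {φ ψ : H}
    (h : ∀ z, ⟪φ, displacement z ψ⟫_ℂ = 0) : φ = 0 ∨ ψ = 0 := by
  have key : ∀ q : ℝ, ∀ᵐ x, ‖φ x‖ₑ * ‖ψ (x - q)‖ₑ = 0 := by
    intro q
    have hψ := (Lp.memLp ψ).comp_measurePreserving (measurePreserving_sub q)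
    have hint : Integrable (fun x => (starRingEnd ℂ) (φ x) * ψ (x - q)) volume :=
      MemLp.integrable_mul (p := 2) (q := 2) (Lp.memLp φ).star hψ
    have hz := ae_eq_zero_of_fourier_eq_zero hint fun ξ => by
      -- For this momentum the matrix element is, up to a phase, the Fourier transform at `ξ` of `x
      -- ↦ conj (φ x) * ψ (x - q)`.
      have h1 := h (q, -(2 * Real.pi * ξ))
      rw [L2.inner_def] at h1
      have h2 : ∫ x, ⟪φ x, displacement (q, -(2 * Real.pi * ξ)) ψ x⟫_ℂ =
          ∫ x, Complex.exp (Complex.I * (q * (Real.pi * ξ))) *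
            (Real.fourierChar (-(x * ξ)) • ((starRingEnd ℂ) (φ x) * ψ (x - q))) := by
        refine integral_congr_ae ?_
        filter_upwards [displacement_coeFn (q, -(2 * Real.pi * ξ)) ψ] with x hx
        rw [hx, RCLike.inner_apply', Circle.smul_def, Real.fourierChar_apply, smul_eq_mul, phase]
        have : Complex.exp (Complex.I * (((-(2 * Real.pi * ξ) : ℝ) : ℂ) * x -
            q * ((-(2 * Real.pi * ξ) : ℝ) : ℂ) / 2)) =
            Complex.exp (Complex.I * (q * (Real.pi * ξ))) *
              Complex.exp (((2 * Real.pi * -(x * ξ) : ℝ) : ℂ) * Complex.I) := by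
          rw [← Complex.exp_add]
          congr 1
          push_cast
          ring
        simp only [this]
        ring
      rw [h2, integral_const_mul] at h1
      rcases mul_eq_zero.1 h1 with h3 | h3
      · exact absurd h3 (Complex.exp_ne_zero _)
      · rw [Real.fourier_real_eq]
        exact h3
    filter_upwards [hz] with x hx
    have : ‖(starRingEnd ℂ) (φ x) * ψ (x - q)‖ₑ = 0 := by rw [hx]; simp
    rw [enorm_mul] at this
    simpa using this
  have hφm : Measurable fun x => ‖φ x‖ₑ := (Lp.stronglyMeasurable φ).measurable.enorm
  have hψm : Measurable fun x => ‖ψ x‖ₑ := (Lp.stronglyMeasurable ψ).measurable.enorm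
  -- By Tonelli the double integral is the product of the `L¹` norms, possibly infinite, of `φ` and
  -- `ψ`; one factor must vanish.
  have h1 : ∫⁻ q : ℝ, ∫⁻ x : ℝ, ‖φ x‖ₑ * ‖ψ (x - q)‖ₑ = 0 := by
    have : ∀ q : ℝ, ∫⁻ x : ℝ, ‖φ x‖ₑ * ‖ψ (x - q)‖ₑ = 0 := fun q => by
      rw [lintegral_congr_ae (key q)]; simp
    simp [this]
  rw [lintegral_lintegral_swap (by
    refine Measurable.aemeasurable ?_
    exact (hφm.comp measurable_snd).mul (hψm.comp (measurable_snd.sub measurable_fst)))] at h1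
  have h2 : ∀ x : ℝ, ∫⁻ q : ℝ, ‖φ x‖ₑ * ‖ψ (x - q)‖ₑ = ‖φ x‖ₑ * ∫⁻ y, ‖ψ y‖ₑ := by
    intro x
    rw [lintegral_const_mul _ (f := fun q => ‖ψ (x - q)‖ₑ)
        (hψm.comp (measurable_const.sub measurable_id)),
      lintegral_sub_left_eq_self (fun y => ‖ψ y‖ₑ) x]
  simp only [h2] at h1
  rw [lintegral_mul_const _ hφm] at h1
  have h3 : ∀ χ : H, ∫⁻ y, ‖χ y‖ₑ = 0 → χ = 0 := by
    intro χ hχ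
    rw [lintegral_eq_zero_iff (Lp.stronglyMeasurable χ).measurable.enorm] at hχ
    rw [Lp.eq_zero_iff_ae_eq_zero]
    filter_upwards [hχ] with x hx
    simpa using hx
  exact (mul_eq_zero.1 h1).imp (h3 φ) (h3 ψ)

theorem nontrivial_H : Nontrivial H := by
  have hfin : volume (Set.Icc (0 : ℝ) 1) ≠ ⊤ := by simp
  refine ⟨indicatorConstLp 2 measurableSet_Icc hfin (1 : ℂ), 0, fun h => ?_⟩
  have h1 := congrArg norm h
  rw [norm_indicatorConstLp (by simp) (by simp)] at h1
  simp at h1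

/-- A vector orthogonal to `K` is orthogonal to the whole orbit of a nonzero `ψ ∈ K`, hence zero. -/
theorem eq_bot_or_eq_top_of_displacement_invariant (K : Submodule ℂ H)
    (hK : IsClosed (K : Set H)) (hinv : ∀ z, ∀ ψ ∈ K, displacement z ψ ∈ K) : K = ⊥ ∨ K = ⊤ := by
  rw [or_iff_not_imp_left]
  intro hne
  obtain ⟨ψ, hψ, hψ0⟩ := Submodule.exists_mem_ne_zero_of_ne_bot hne
  have : CompleteSpace K := hK.completeSpace_coe
  rw [← Submodule.orthogonal_eq_bot_iff, Submodule.eq_bot_iff]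
  intro φ hφ
  refine (eq_zero_of_inner_displacement_eq_zero fun z => ?_).resolve_right hψ0
  exact (Submodule.mem_orthogonal' K φ).1 hφ _ (hinv z ψ hψ)

end Irreducible

/-! ### Tilted Weyl operators and the obstruction to equivalence. -/

section Tilted

/-- The inverse of `tilt θ`. -/
def untilt (θ : ℝ) (z : ℝ × ℝ) : ℝ × ℝ := (z.1, (z.2 - z.1 * Real.cos θ) / Real.sin θ)

theorem bijective_tilt {θ : ℝ} (hs : Real.sin θ ≠ 0) : Function.Bijective (tilt θ) := by
  refine Function.bijective_iff_has_inverse.2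
    ⟨untilt θ, fun z => ?_, fun z => ?_⟩
  · ext
    · rfl
    · simp [tilt, untilt, hs]
  · ext
    · rfl
    · simp only [tilt, untilt, LinearMap.coe_mk, AddHom.coe_mk]
      field_simp
      ring

theorem tiltedWeyl_eq {θ : ℝ} (hs : Real.sin θ ≠ 0) (z : ℝ × ℝ) :
    tiltedWeyl θ z = displacement (untilt θ z) := by
  rw [tiltedWeyl, weyl_eq_displacement]
  congr 1
  have hb := bijective_tilt hs
  apply hb.1
  rw [Function.rightInverse_invFun hb.2 z]
  ext
  · rfl
  · simp only [tilt, untilt, LinearMap.coe_mk, AddHom.coe_mk]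
    field_simp
    ring

/-- The inverse tilt has determinant `1 / sin θ`, the factor by which it scales the symplectic form.
-/
theorem weylMultiplier_untilt {θ : ℝ} (hs : Real.sin θ ≠ 0) (z w : ℝ × ℝ) :
    weylMultiplier (untilt θ z) (untilt θ w) = tiltedMultiplier θ z w := by
  have hs' : (Real.sin θ : ℂ) ≠ 0 := by exact_mod_cast hs
  simp only [weylMultiplier, tiltedMultiplier, untilt]
  congr 2
  push_cast [-Complex.ofReal_sin, -Complex.ofReal_cos]
  field_simp
  ring

theorem untilt_add (θ : ℝ) (z w : ℝ × ℝ) : untilt θ (z + w) = untilt θ z + untilt θ w := by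
  ext
  · rfl
  · simp only [untilt, Prod.snd_add, Prod.fst_add, ← add_div]
    ring

theorem isProjectiveUnitaryRep_tiltedWeyl {θ : ℝ} (hs : Real.sin θ ≠ 0) :
    IsProjectiveUnitaryRep (tiltedMultiplier θ) (tiltedWeyl θ) where
  unitary z := tiltedWeyl_eq hs z ▸ displacement_mem_unitary _
  norm_multiplier z w := weylMultiplier_untilt hs z w ▸ norm_weylMultiplier _ _
  add z w := by
    rw [tiltedWeyl_eq hs, tiltedWeyl_eq hs, tiltedWeyl_eq hs, untilt_add, displacement_add,
      weylMultiplier_untilt hs]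
  continuous ψ := by
    simp only [tiltedWeyl_eq hs]
    exact (continuous_displacement ψ).comp (by unfold untilt; fun_prop)

theorem isIrreducible_tiltedWeyl {θ : ℝ} (hs : Real.sin θ ≠ 0) :
    IsIrreducible (tiltedWeyl θ) := by
  refine ⟨nontrivial_H, fun K hK hinv => ?_⟩
  refine eq_bot_or_eq_top_of_displacement_invariant K hK fun z ψ hψ => ?_
  have h := hinv (tilt θ z) ψ hψ
  rwa [tiltedWeyl, Function.leftInverse_invFun (bijective_tilt hs).1 z, weyl_eq_displacement] at h

theorem tiltedWeyl_explicit {θ : ℝ} (hs : Real.sin θ ≠ 0) (q p : ℝ) :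
    tiltedWeyl θ (q, p) = Complex.exp (Complex.I * (q * p / (2 * Real.sin θ))) •
      (expI (quadrature θ) (-q / Real.sin θ) * expI position (p / Real.sin θ)) := by
  have h : untilt θ (q, p) = ray (Real.cos θ) (Real.sin θ) (-q / Real.sin θ) +
      ray 1 0 (p / Real.sin θ) := by
    ext
    · simp only [untilt, ray, Prod.fst_add]
      field_simp
      ring
    · simp only [untilt, ray, Prod.snd_add]
      field_simp
      ring
  rw [tiltedWeyl_eq hs, h, quadrature_eq, position_eq, expI_linComb, expI_linComb,
    displacement_add]
  congr 1
  have hs' : (Real.sin θ : ℂ) ≠ 0 := by exact_mod_cast hs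
  simp only [weylMultiplier, ray]
  congr 2
  push_cast [-Complex.ofReal_sin, -Complex.ofReal_cos]
  field_simp
  ring

theorem displacement_commute (z w : ℝ × ℝ) :
    displacement z * displacement w =
      Complex.exp (Complex.I * (z.2 * w.1 - z.1 * w.2)) • (displacement w * displacement z) := by
  have h1 := displacement_add z w
  rw [add_comm, displacement_add] at h1
  have h2 : weylMultiplier z w ≠ 0 := Complex.exp_ne_zero _
  refine smul_right_injective _ h2 ?_
  simp only
  rw [← h1, smul_smul]
  congr 1
  simp only [weylMultiplier, ← Complex.exp_add]
  congr 1
  ring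

/-- The phases `c` cancel from commutation relations, so the commutation phases must agree: `e^{-it}
= e^{-it / sin θ}` for every real `t`. -/
theorem sin_eq_one_of_equivalent {θ : ℝ} (hs : Real.sin θ ≠ 0)
    (h : UnitarilyEquivalentUpToPhase weyl (tiltedWeyl θ)) : Real.sin θ = 1 := by
  obtain ⟨V, c, hc, hV⟩ := h
  simp only [weyl_eq_displacement, tiltedWeyl_eq hs] at hV
  have hc0 : ∀ z, c z ≠ 0 := fun z => norm_ne_zero_iff.1 (by rw [hc]; exact one_ne_zero)
  obtain ⟨ψ, hψ⟩ := @exists_ne H nontrivial_H 0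
  have hd0 : ∀ z (φ : H), φ ≠ 0 → displacement z φ ≠ 0 := fun z φ hφ =>
    norm_ne_zero_iff.1 (by rw [norm_displacement]; exact norm_ne_zero_iff.2 hφ)
  have hexp : ∀ t : ℝ, Complex.exp (Complex.I * -t) =
      Complex.exp (Complex.I * -(t / Real.sin θ : ℝ)) := by
    intro t
    have h1 := congrArg V (congrArg (fun T : H →L[ℂ] H => T ψ) (displacement_commute (1, 0) (0, t)))
    simp only [smul_apply, mul_apply_eq_comp, map_smul, hV] at h1
    have h2 := congrArg (fun T : H →L[ℂ] H => T (V ψ))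
      (displacement_commute (untilt θ (1, 0)) (untilt θ (0, t)))
    simp only [smul_apply, mul_apply_eq_comp] at h2
    rw [h2] at h1
    simp only [smul_smul] at h1
    have h3 := smul_left_injective ℂ
      (hd0 (untilt θ (0, t)) _ (hd0 (untilt θ (1, 0)) _ (V.map_ne_zero_iff.2 hψ))) h1
    have h4 : c (1, 0) * c (0, t) ≠ 0 := mul_ne_zero (hc0 _) (hc0 _)
    have e1 : Complex.exp (Complex.I * -t) =
      Complex.exp (Complex.I * ((((1 : ℝ), (0 : ℝ)).2 : ℝ) * (((0 : ℝ), t).1 : ℝ) -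
        (((1 : ℝ), (0 : ℝ)).1 : ℝ) * (((0 : ℝ), t).2 : ℝ))) := by
      simp
    have e2 : Complex.exp (Complex.I * -(t / Real.sin θ : ℝ)) =
      Complex.exp (Complex.I * ((untilt θ (1, 0)).2 * (untilt θ (0, t)).1 -
        (untilt θ (1, 0)).1 * (untilt θ (0, t)).2)) := by
      simp [untilt]
    rw [e1, e2]
    apply mul_left_cancel₀ h4
    linear_combination -h3
  by_contra hne
  have hκ : 1 / Real.sin θ - 1 ≠ 0 := by
    intro h0
    apply hne
    field_simp at h0
    linarith
  -- This `t` makes the two exponents differ by `iπ`, which would give `-1 = 1`.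
  have h1 := hexp (Real.pi / (1 / Real.sin θ - 1))
  have h2 : Complex.exp (Real.pi * Complex.I) = 1 := by
    set t := Real.pi / (1 / Real.sin θ - 1) with ht
    have h3 : t / Real.sin θ = t + Real.pi := by
      have : t * (1 / Real.sin θ - 1) = Real.pi := div_mul_cancel₀ _ hκ
      rw [← this]; ring
    rw [h3] at h1
    have h4 : Complex.I * -t = Complex.I * -((t + Real.pi : ℝ) : ℂ) + Real.pi * Complex.I := by
      push_cast; ring
    rw [h4, Complex.exp_add] at h1
    exact mul_left_cancel₀ (Complex.exp_ne_zero _) (h1.trans (mul_one _).symm)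
  rw [Complex.exp_pi_mul_I] at h2
  norm_num at h2

end Tilted

end TiltedWeyl

end

open TiltedWeyl in
theorem mainTheorem3 (θ : ℝ) (hθ : θ ∈ Set.Ioo (-Real.pi) 0 ∪ Set.Ioo 0 Real.pi) :
    -- `Q`, `P` and `Q_θ` are self-adjoint, the exponentials are the unitary groups they generate,
    -- and `Q = Q_0`
    (∀ A ∈ ({position, momentum, quadrature θ} : Set (H →ₗ.[ℂ] H)),
      IsSelfAdjoint A ∧ IsUnitaryGroupOf A (expI A)) ∧
    quadrature 0 = position ∧
    -- `f_θ` is a linear bijection, so that `W_θ` is well defined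
    Function.Bijective (tilt θ) ∧
    -- the explicit form of `W_θ`
    (∀ q p : ℝ, tiltedWeyl θ (q, p) =
      Complex.exp (Complex.I * (q * p / (2 * Real.sin θ))) •
        (expI (quadrature θ) (-q / Real.sin θ) * expI position (p / Real.sin θ))) ∧
    -- `W_θ` is an irreducible projective unitary representation with the stated multiplier
    IsProjectiveUnitaryRep (tiltedMultiplier θ) (tiltedWeyl θ) ∧
    IsIrreducible (tiltedWeyl θ) ∧
    -- `W_θ` is unitarily equivalent to `W` only for `θ = π / 2`, even up to phases
    (UnitarilyEquivalent weyl (tiltedWeyl θ) ↔ θ = Real.pi / 2) ∧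
    (UnitarilyEquivalentUpToPhase weyl (tiltedWeyl θ) ↔ θ = Real.pi / 2) := by
  have hs : Real.sin θ ≠ 0 := by
    rcases hθ with h | h
    · exact (Real.sin_neg_of_neg_of_neg_pi_lt h.2 h.1).ne
    · exact (Real.sin_pos_of_pos_of_lt_pi h.1 h.2).ne'
  have hgen : ∀ c s : ℝ, IsSelfAdjoint (schwartzOp (linComb c s)).closure ∧
      IsUnitaryGroupOf (schwartzOp (linComb c s)).closure
        (expI (schwartzOp (linComb c s)).closure) := by
    intro c s
    obtain ⟨-, h1, h2⟩ := schwartzOp_linComb c s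
    exact ⟨h1, by rwa [expI_eq h1.dense_domain h2]⟩
  have hphase : UnitarilyEquivalent weyl (tiltedWeyl θ) →
      UnitarilyEquivalentUpToPhase weyl (tiltedWeyl θ) := fun ⟨V, hV⟩ =>
    ⟨V, fun _ => 1, fun _ => norm_one, fun x ψ => by rw [hV, one_smul]⟩
  have honly : UnitarilyEquivalentUpToPhase weyl (tiltedWeyl θ) → θ = Real.pi / 2 := by
    intro h
    have h1 := sin_eq_one_of_equivalent hs h
    rw [← Real.cos_sub_pi_div_two] at h1
    have hb : -Real.pi < θ ∧ θ < Real.pi := by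
      rcases hθ with h | h
      · exact ⟨h.1, h.2.trans Real.pi_pos⟩
      · exact ⟨(neg_lt_zero.2 Real.pi_pos).trans h.1, h.2⟩
    -- The range of `θ` keeps `θ - π/2` strictly between `-2π` and `2π`, where the cosine is `1`
    -- only at `0`.
    have h2 := (Real.cos_eq_one_iff_of_lt_of_lt (by linarith [Real.pi_pos])
      (by linarith [Real.pi_pos])).1 h1
    linarith
  have hif : θ = Real.pi / 2 → UnitarilyEquivalent weyl (tiltedWeyl θ) := by
    intro h
    refine ⟨LinearIsometryEquiv.refl ℂ H, fun z ψ => ?_⟩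
    rw [tiltedWeyl_eq hs, weyl_eq_displacement]
    simp [untilt, h]
  refine ⟨?_, ?_, bijective_tilt hs, tiltedWeyl_explicit hs, isProjectiveUnitaryRep_tiltedWeyl hs,
    isIrreducible_tiltedWeyl hs, ⟨fun h => honly (hphase h), hif⟩, ⟨honly, fun h => hphase (hif h)⟩⟩
  · rintro A (rfl | rfl | rfl)
    · rw [position_eq]; exact hgen 1 0
    · rw [momentum_eq]; exact hgen 0 1
    · rw [quadrature_eq]; exact hgen _ _
  · rw [quadrature_eq, position_eq, Real.cos_zero, Real.sin_zero]
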